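/- Let $0<a<b$ with $a+b<1$. The Moran set $C_{ab}\subset[0,1]$ is obtained from $[0,1]$ (the Moran interval of step $0$) by replacing, at each step, every Moran interval $I$ by its left child (the leftmost closed subinterval of $I$, of length $a|I|$) and its right child (the rightmost closed subinterval of $I$, of length $b|I|$), and intersecting over all steps. Fix $0<p<1/2$ and let $p_1,p_2,\dots$ be independent random variables on a probability space $(\Omega,\mathcal P)$, each uniformly distributed on the two-point set $\{p,1-p\}$. For $\omega\in\Omega$ let $\mu_\omega$ be the Borel probability measure on $C_{ab}$ such that, for every $n\ge 0$ and every Moran interval $I$ of step $n$, the left child of $I$ has measure $p_{n+1}(\omega)\mu_\omega(I)$ and the right child has measure $(1-p_{n+1}(\omega))\mu_\omega(I)$. A dimension function is a map $\Phi:(0,1)\to[0,\infty)$ such that $t^{1+\Phi(t)}$ decreases to $0$ as $t$ decreases to $0$. It is called large if $\Phi(t)=H(t)\,\dfrac{\log|\log t|}{|\log t|}$ for all $t$ near $0$, where $H(t)\to\infty$ as $t\to0^+$. The upper $\Phi$-dimension $\overline{\dim}_\Phi\mu$ of a measure $\mu$ is the infimum of the $d\in\mathbb R$ for which there are $C_1,C_2>0$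 such that $$\frac{\mu(B(x,R))}{\mu(B(x,r))}\le C_2\Big(\frac Rr\Big)^d\qquad\text{for all } 0<r<R^{1+\Phi(R)}\le R\le C_1\ (R<1)\text{ and all } x\in\operatorname{supp}\mu ,$$ where $B(x,R)$ is the open ball of radius $R$ centred at $x$. Define real numbers $\beta$ and $\eta$ by $a^\beta=b$ and $(1-p)^\eta=p$. Then there is a set $\Gamma\subseteq\Omega$ of full measure such that, for every $\omega\in\Gamma$ and every large dimension function $\Phi$, $$\overline{\dim}_\Phi\mu_\omega=\begin{cases}\dfrac{\log p+\log(1-p)}{2\log b} & \text{if } \eta+1+\beta-3\eta\beta\ge 0,\\[2ex] \dfrac{\log p}{\frac12(\log a+\log b)} & \text{if } \eta+1+\beta-3\eta\beta<0.\end{cases}$$ -/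

import Mathlib

open MeasureTheory ProbabilityTheory Filter Topology unitInterval

noncomputable section

/-! ### Dimension functions and the upper dimension of a measure -/

/-- A dimension function is a map from `(0,1)` to the non-negative reals such that `t ^ (1 + Φ t)`
decreases to `0` as `t` decreases to `0`. Only the values of `Φ` on `(0,1)` are relevant. -/
structure IsDimensionFunction (Φ : ℝ → ℝ) : Prop where
  nonneg : ∀ t ∈ Set.Ioo (0 : ℝ) 1, 0 ≤ Φ t
  monotoneOn : MonotoneOn (fun t : ℝ => t ^ (1 + Φ t)) (Set.Ioo (0 : ℝ) 1)
  tendsto_zero : Tendsto (fun t : ℝ => t ^ (1 + Φ t)) (𝓝[>] 0) (𝓝 0)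

/-- `Φ` is large if `Φ t = H t * log |log t| / |log t|` for `t` near `0`, where `H t → ∞` as
`t → 0`. -/
def IsLargeDimensionFunction (Φ : ℝ → ℝ) : Prop :=
  ∃ H : ℝ → ℝ, Tendsto H (𝓝[>] 0) atTop ∧
    ∀ᶠ t in 𝓝[>] (0 : ℝ), Φ t = H t * (Real.log |Real.log t| / |Real.log t|)

/-- `d` is an admissible exponent: there are `C₁, C₂ > 0` such that, for all
`0 < r < R ^ (1 + Φ R) ≤ R ≤ C₁` (with `R` in the domain `(0,1)` of `Φ`) and all `x` in the support
of `μ`, `μ (B(x,R)) / μ (B(x,r)) ≤ C₂ (R / r) ^ d`. -/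
def IsUpperPhiExponent {X : Type*} [PseudoMetricSpace X] [MeasurableSpace X]
    (Φ : ℝ → ℝ) (μ : Measure X) (d : ℝ) : Prop :=
  ∃ C₁ > (0 : ℝ), ∃ C₂ > (0 : ℝ), ∀ r R : ℝ, R ∈ Set.Ioo (0 : ℝ) 1 →
    0 < r → r < R ^ (1 + Φ R) → R ^ (1 + Φ R) ≤ R → R ≤ C₁ →
    ∀ x ∈ μ.support,
      μ (Metric.ball x R) / μ (Metric.ball x r) ≤ ENNReal.ofReal (C₂ * (R / r) ^ d)

/-- The upper `Φ`-dimension of a measure: the infimum, in the extended reals, of the admissible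
exponents. -/
def upperPhiDim {X : Type*} [PseudoMetricSpace X] [MeasurableSpace X]
    (Φ : ℝ → ℝ) (μ : Measure X) : EReal :=
  sInf ((fun d : ℝ => (d : EReal)) '' {d : ℝ | IsUpperPhiExponent Φ μ d})

/-! ### The Moran set `C_{ab}`

Children are labelled by `false` (left) and `true` (right). A Moran interval of step `n` is
described by an infinite word `v`, of which only the first `n` letters matter. -/

/-- Length of the Moran interval of step `n` along `v`. -/
def moranLength (a b : ℝ) (v : ℕ → Bool) : ℕ → ℝ
  | 0 => 1
  | n + 1 => (if v n then b else a) * moranLength a b v n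

/-- Left end point of the Moran interval of step `n` along `v`: a left child shares the left end
point of its parent, a right child shares the right end point. -/
def moranLeft (a b : ℝ) (v : ℕ → Bool) : ℕ → ℝ
  | 0 => 0
  | n + 1 => moranLeft a b v n + (if v n then (1 - b) * moranLength a b v n else 0)

/-- The Moran interval of step `n` along `v`. -/
def moranInterval (a b : ℝ) (v : ℕ → Bool) (n : ℕ) : Set ℝ :=
  Set.Icc (moranLeft a b v n) (moranLeft a b v n + moranLength a b v n)

/-- The Moran set `C_{ab}`. -/
def moranSet (a b : ℝ) : Set ℝ :=
  ⋂ n : ℕ, ⋃ v : ℕ → Bool, moranInterval a b v n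

/-- The point of `C_{ab}` with address `v`: the limit of the (non-decreasing) left end points of the
Moran intervals along `v`. -/
def moranPoint (a b : ℝ) (v : ℕ → Bool) : ℝ :=
  ⨆ n : ℕ, moranLeft a b v n

/-- The Moran measure on `C_{ab}` with probabilities `p 0, p 1, …`: at step `n + 1` each Moran
interval of step `n` gives the fraction `p n` of its mass to its left child and the fraction
`1 - p n` to its right child. It is the image under the address map of the product of the measures
`p n • δ_false + (1 - p n) • δ_true`; see `moranMeasure_moranInterval_succ` for the mass rule. -/
def moranMeasure (a b : ℝ) (p : ℕ → I) : Measure ℝ :=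
  (Measure.infinitePi fun n => bernoulliMeasure false true (p n)).map (moranPoint a b)

/-! ### The Moran measure is a probability measure on `C_{ab}` and obeys the mass rule -/

section Facts

variable {a b : ℝ}

theorem moranLength_pos (ha : 0 < a) (hb : 0 < b) (v : ℕ → Bool) (n : ℕ) :
    0 < moranLength a b v n := by
  induction n with
  | zero => simp [moranLength]
  | succ n ih =>
    simp only [moranLength]
    split_ifs <;> positivity

theorem moran_congr {v w : ℕ → Bool} {n : ℕ} (h : ∀ i < n, w i = v i) :
    moranLength a b w n = moranLength a b v n ∧ moranLeft a b w n = moranLeft a b v n := by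
  induction n with
  | zero => simp [moranLength, moranLeft]
  | succ n ih =>
    obtain ⟨h1, h2⟩ := ih fun i hi => h i (by omega)
    simp [moranLength, moranLeft, h1, h2, h n (by omega)]

theorem moranInterval_congr {v w : ℕ → Bool} {n : ℕ} (h : ∀ i < n, w i = v i) :
    moranInterval a b w n = moranInterval a b v n := by
  simp only [moranInterval, (moran_congr h).1, (moran_congr h).2]

theorem moranLeft_mono (ha : 0 < a) (hb : 0 < b) (hab : a + b < 1) (v : ℕ → Bool) :
    Monotone (moranLeft a b v) := by
  refine monotone_nat_of_le_succ fun n => ?_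
  have := moranLength_pos ha hb v n
  simp only [moranLeft]
  split_ifs
  · nlinarith
  · simp

theorem moranRight_anti (ha : 0 < a) (hb : 0 < b) (hab : a + b < 1) (v : ℕ → Bool) :
    Antitone fun n => moranLeft a b v n + moranLength a b v n := by
  refine antitone_nat_of_succ_le fun n => ?_
  have := moranLength_pos ha hb v n
  simp only [moranLeft, moranLength]
  split_ifs <;> nlinarith

theorem moranLeft_le_right (ha : 0 < a) (hb : 0 < b) (hab : a + b < 1) (v : ℕ → Bool) (m n : ℕ) :
    moranLeft a b v m ≤ moranLeft a b v n + moranLength a b v n := by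
  have h1 := moranLeft_mono ha hb hab v (le_max_left m n)
  have h2 := moranRight_anti ha hb hab v (le_max_right m n)
  have h3 := moranLength_pos ha hb v (max m n)
  simp only at h2
  linarith

theorem moranPoint_mem (ha : 0 < a) (hb : 0 < b) (hab : a + b < 1) (v : ℕ → Bool) (n : ℕ) :
    moranPoint a b v ∈ moranInterval a b v n := by
  have hbdd : BddAbove (Set.range (moranLeft a b v)) := by
    refine ⟨moranLeft a b v 0 + moranLength a b v 0, ?_⟩
    rintro _ ⟨m, rfl⟩
    exact moranLeft_le_right ha hb hab v m 0
  exact ⟨le_ciSup hbdd n, ciSup_le fun m => moranLeft_le_right ha hb hab v m n⟩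

theorem moranInterval_succ_subset (ha : 0 < a) (hb : 0 < b) (hab : a + b < 1) (v : ℕ → Bool)
    (n : ℕ) : moranInterval a b v (n + 1) ⊆ moranInterval a b v n :=
  Set.Icc_subset_Icc (moranLeft_mono ha hb hab v n.le_succ)
    (moranRight_anti ha hb hab v n.le_succ)

theorem moranPoint_mem_iff (ha : 0 < a) (hb : 0 < b) (hab : a + b < 1) (v w : ℕ → Bool) (n : ℕ) :
    moranPoint a b w ∈ moranInterval a b v n ↔ ∀ i < n, w i = v i := by
  refine ⟨fun h => ?_, fun h => moranInterval_congr h ▸ moranPoint_mem ha hb hab w n⟩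
  induction n with
  | zero => simp
  | succ n ih =>
    have hn := ih (moranInterval_succ_subset ha hb hab v n h)
    have hw := moranPoint_mem ha hb hab w (n + 1)
    have hL := moranLength_pos ha hb v n
    intro i hi
    rcases Nat.lt_succ_iff_lt_or_eq.1 hi with hi | rfl
    · exact hn i hi
    · simp only [moranInterval, moranLeft, moranLength, (moran_congr hn).1, (moran_congr hn).2,
        Set.mem_Icc] at h hw
      by_contra hne
      cases hv : v i <;> cases hw' : w i <;> simp_all <;> nlinarith

theorem measurable_moranPoint (a b : ℝ) : Measurable (moranPoint a b) := by
  have hlen : ∀ n, Measurable fun v : ℕ → Bool => moranLength a b v n := by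
    intro n
    induction n with
    | zero => exact measurable_const
    | succ n ih =>
      exact ((Measurable.of_discrete (f := fun c : Bool => if c then b else a)).comp
        (measurable_pi_apply n)).mul ih
  have hleft : ∀ n, Measurable fun v : ℕ → Bool => moranLeft a b v n := by
    intro n
    induction n with
    | zero => exact measurable_const
    | succ n ih =>
      refine ih.add (Measurable.ite ?_ (measurable_const.mul (hlen n)) measurable_const)
      exact (measurable_pi_apply (X := fun _ : ℕ => Bool) n)
        (MeasurableSet.of_discrete (s := {c : Bool | c = true}))
  exact Measurable.iSup hleft

instance isProbabilityMeasure_moranMeasure (a b : ℝ) (p : ℕ → I) :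
    IsProbabilityMeasure (moranMeasure a b p) :=
  Measure.isProbabilityMeasure_map (measurable_moranPoint a b).aemeasurable

theorem moranMeasure_moranInterval (ha : 0 < a) (hb : 0 < b) (hab : a + b < 1) (p : ℕ → I)
    (v : ℕ → Bool) (n : ℕ) :
    moranMeasure a b p (moranInterval a b v n) =
      ∏ i ∈ Finset.range n, ENNReal.ofReal (if v i then 1 - (p i : ℝ) else p i) := by
  have h : moranPoint a b ⁻¹' moranInterval a b v n =
      Set.pi (Finset.range n : Finset ℕ) fun i => {v i} := by
    ext w
    simp [moranPoint_mem_iff ha hb hab, Set.mem_pi]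
  have hI : MeasurableSet (moranInterval a b v n) := measurableSet_Icc
  rw [moranMeasure, Measure.map_apply (measurable_moranPoint a b) hI, h,
    Measure.infinitePi_pi _ fun i _ => MeasurableSet.of_discrete]
  refine Finset.prod_congr rfl fun i _ => ?_
  rw [← ENNReal.ofReal_toReal (measure_ne_top (bernoulliMeasure false true (p i)) {v i})]
  change ENNReal.ofReal ((bernoulliMeasure false true (p i)).real {v i}) = _
  rw [bernoulliMeasure_real_apply (p i) (MeasurableSet.of_discrete)]
  cases v i <;> simp

/-- The mass rule that determines the measure: a left child receives the fraction `p n` of the mass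
of its parent of step `n`, and a right child the fraction `1 - p n`. -/
theorem moranMeasure_moranInterval_succ (ha : 0 < a) (hb : 0 < b) (hab : a + b < 1) (p : ℕ → I)
    (v : ℕ → Bool) (n : ℕ) :
    moranMeasure a b p (moranInterval a b v (n + 1)) =
      ENNReal.ofReal (if v n then 1 - (p n : ℝ) else p n) *
        moranMeasure a b p (moranInterval a b v n) := by
  rw [moranMeasure_moranInterval ha hb hab, moranMeasure_moranInterval ha hb hab,
    Finset.prod_range_succ, mul_comm]

/-- The Moran measure is carried by `C_{ab}`. -/
theorem ae_mem_moranSet (ha : 0 < a) (hb : 0 < b) (hab : a + b < 1) (p : ℕ → I) :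
    ∀ᵐ x ∂(moranMeasure a b p), x ∈ moranSet a b := by
  have hsub : Set.range (moranPoint a b) ⊆ moranSet a b := by
    rintro _ ⟨v, rfl⟩
    exact Set.mem_iInter.2 fun n => Set.mem_iUnion.2 ⟨v, moranPoint_mem ha hb hab v n⟩
  have hmeas : MeasurableSet (moranSet a b) := by
    refine MeasurableSet.iInter fun n => ?_
    have hcover : (⋃ v : ℕ → Bool, moranInterval a b v n) =
        ⋃ u : Fin n → Bool,
          moranInterval a b (fun i => if h : i < n then u ⟨i, h⟩ else false) n := by
      ext x
      simp only [Set.mem_iUnion]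
      refine ⟨fun ⟨v, hv⟩ => ⟨fun i => v i, ?_⟩, fun ⟨u, hu⟩ => ⟨_, hu⟩⟩
      rwa [moranInterval_congr (v := v) fun i hi => by simp [hi]]
    rw [hcover]
    exact MeasurableSet.iUnion fun u => measurableSet_Icc
  exact (ae_map_iff (p := fun x => x ∈ moranSet a b) (measurable_moranPoint a b).aemeasurable
    hmeas).2 (Eventually.of_forall fun v => hsub ⟨v, rfl⟩)

end Facts

end

/-!
Let `L_n` and `M_n` be the length and the mass of the Moran interval of step `n` around a point `x`
of the Moran set. The two children of an interval are separated by a gap comparable with its length,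
so `μ (B(x,R)) / μ (B(x,r))` is comparable with `M_j / M_k` for levels with `L_j ~ R` and `L_k ~ r`.

Fix `D`. At each step `-log M` increases by at most `D` times the increase of `-log L`, plus an
excess that depends only on the random weight at that step, and a suitable choice of the child gives
equality. The value `D` in the theorem is the one for which the excess has mean zero. By Hoeffding's
inequality and the Borel-Cantelli lemma the excesses then almost surely have a negligible sum over
every window `[j, k)` with `k - j ≥ K log j`, where `K` is a large constant. A large dimension
function is what guarantees `k - j ≥ K log j` whenever `r < R ^ (1 + Φ R)`, so every `d > D` is
an admissible exponent; following the children with equality shows that no `d < D` is.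
-/

open Real

section WindowSums

/-- The sums of `y` over windows are negligible compared with the length of the window, as soon as
this length exceeds a suitable multiple of the logarithm of the starting point. -/
def HasSmallWindowSums (y : ℕ → ℝ) : Prop :=
  ∀ ε > 0, ∃ K ≥ 0, ∀ᶠ j : ℕ in atTop, ∀ m : ℕ, K * log (j + 1) ≤ m →
    |∑ i ∈ Finset.range m, y (j + i)| ≤ ε * m

theorem HasSmallWindowSums.sum_range_isLittleO {y : ℕ → ℝ} (hy : HasSmallWindowSums y) :
    (fun n => ∑ i ∈ Finset.range n, y i) =o[atTop] fun n : ℕ => (n : ℝ) := by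
  refine Asymptotics.isLittleO_iff.2 fun ε hε => ?_
  obtain ⟨K, -, hK⟩ := hy (ε / 2) (half_pos hε)
  obtain ⟨j, hj⟩ := hK.exists
  have hcast : Tendsto (fun n : ℕ => (n : ℝ)) atTop atTop := tendsto_natCast_atTop_atTop
  filter_upwards [eventually_ge_atTop j, hcast.eventually_ge_atTop (j + K * log (j + 1)),
    (hcast.const_mul_atTop (half_pos hε)).eventually_ge_atTop |∑ i ∈ Finset.range j, y i|]
    with n hjn hlog hinit
  obtain ⟨m, rfl⟩ := Nat.exists_eq_add_of_le hjn
  push_cast at hlog hinit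
  have hwindow := hj m (by linarith)
  have hεj : 0 ≤ ε / 2 * j := by positivity
  rw [Finset.sum_range_add, norm_eq_abs, norm_natCast]
  push_cast
  linarith [abs_add_le (∑ i ∈ Finset.range j, y i) (∑ i ∈ Finset.range m, y (j + i))]

variable {Ω : Type*} [MeasurableSpace Ω] {P : Measure Ω} {Y : ℕ → Ω → ℝ} {c : NNReal}

theorem measureReal_abs_window_sum_ge_le (hindep : iIndepFun Y P)
    (hsub : ∀ n, HasSubgaussianMGF (Y n) c P) (j m : ℕ) {ε : ℝ} (hε : 0 ≤ ε) :
    P.real {ω | ε ≤ |∑ i ∈ Finset.range m, Y (j + i) ω|} ≤ 2 * exp (-ε ^ 2 / (2 * m * c)) := by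
  have := hindep.isProbabilityMeasure
  have hwindow : iIndepFun (fun i => Y (j + i)) P := hindep.precomp (add_right_injective j)
  have hupper := HasSubgaussianMGF.measure_sum_range_ge_le_of_iIndepFun (n := m) hwindow
    (fun i _ => hsub (j + i)) hε
  have hlower := HasSubgaussianMGF.measure_sum_range_ge_le_of_iIndepFun (n := m)
    (hwindow.comp (fun _ t => -t) fun _ => measurable_neg) (fun i _ => (hsub (j + i)).neg) hε
  simp only [Function.comp_apply, Finset.sum_neg_distrib] at hlower
  calc P.real {ω | ε ≤ |∑ i ∈ Finset.range m, Y (j + i) ω|}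
      = P.real ({ω | ε ≤ ∑ i ∈ Finset.range m, Y (j + i) ω} ∪
          {ω | ε ≤ -∑ i ∈ Finset.range m, Y (j + i) ω}) := by simp only [le_abs, Set.ofPred_or]
    _ ≤ 2 * exp (-ε ^ 2 / (2 * m * c)) := (measureReal_union_le _ _).trans (by linarith)

theorem exp_neg_mul_le_of_log_le {κ : ℝ} (hκ : 0 < κ) {j m : ℕ} (h : 4 / κ * log (j + 1) ≤ m) :
    exp (-(κ * m)) ≤ 1 / (j + 1) ^ 2 * exp (-(κ / 2)) ^ m := by
  have hinv_sq : 1 / ((j : ℝ) + 1) ^ 2 = exp (-(2 * log (j + 1))) := by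
    rw [exp_neg, mul_comm, exp_mul, exp_log (by positivity), one_div, rpow_two]
  rw [hinv_sq, ← exp_nat_mul, ← exp_add, exp_le_exp]
  rw [div_mul_eq_mul_div, div_le_iff₀ hκ] at h
  linarith

theorem summable_inv_sq_mul_exp_pow {κ : ℝ} (hκ : 0 < κ) :
    Summable fun jm : ℕ × ℕ => 1 / ((jm.1 : ℝ) + 1) ^ 2 * exp (-κ) ^ jm.2 := by
  have hsq : Summable fun j : ℕ => 1 / ((j : ℝ) + 1) ^ 2 := by
    exact_mod_cast (summable_nat_add_iff 1).2 (summable_one_div_nat_pow.2 one_lt_two)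
  have hgeom : Summable fun m : ℕ => exp (-κ) ^ m :=
    summable_geometric_of_lt_one (exp_nonneg _) (exp_lt_one_iff.2 (neg_lt_zero.2 hκ))
  exact hsq.mul_of_nonneg hgeom (fun _ => by positivity) fun _ => by positivity

theorem measureReal_abs_window_sum_ge_le_of_log_le (hindep : iIndepFun Y P) (hc : 0 < c)
    (hsub : ∀ n, HasSubgaussianMGF (Y n) c P) {ε κ : ℝ} (hε : 0 < ε) (hκ : κ = ε ^ 2 / (2 * c))
    {j m : ℕ} (hjm : 4 / κ * log (j + 1) ≤ m) :
    P.real {ω | ε * m ≤ |∑ i ∈ Finset.range m, Y (j + i) ω|} ≤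
      2 * (1 / ((j : ℝ) + 1) ^ 2 * exp (-(κ / 2)) ^ m) := by
  have hκ0 : 0 < κ := by rw [hκ]; positivity
  calc P.real {ω | ε * m ≤ |∑ i ∈ Finset.range m, Y (j + i) ω|}
      ≤ 2 * exp (-(ε * m) ^ 2 / (2 * m * c)) :=
        measureReal_abs_window_sum_ge_le hindep hsub j m (by positivity)
    _ = 2 * exp (-(κ * m)) := by
        congr 2
        rcases eq_or_ne m 0 with rfl | hm
        · simp
        · rw [hκ]
          field_simp
    _ ≤ 2 * (1 / ((j : ℝ) + 1) ^ 2 * exp (-(κ / 2)) ^ m) := by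
        gcongr
        exact exp_neg_mul_le_of_log_le hκ0 hjm

theorem exists_ae_eventually_abs_window_sum_le (hindep : iIndepFun Y P) (hc : 0 < c)
    (hsub : ∀ n, HasSubgaussianMGF (Y n) c P) {ε : ℝ} (hε : 0 < ε) :
    ∃ K ≥ 0, ∀ᵐ ω ∂P, ∀ᶠ j : ℕ in atTop, ∀ m : ℕ, K * log (j + 1) ≤ m →
      |∑ i ∈ Finset.range m, Y (j + i) ω| ≤ ε * m := by
  have := hindep.isProbabilityMeasure
  obtain ⟨κ, hκ⟩ : ∃ κ : ℝ, κ = ε ^ 2 / (2 * c) := ⟨_, rfl⟩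
  have hκ0 : 0 < κ := by rw [hκ]; positivity
  let bad : ℕ × ℕ → Set Ω := fun jm =>
    {ω | 4 / κ * log (jm.1 + 1) ≤ jm.2 ∧ ε * jm.2 ≤ |∑ i ∈ Finset.range jm.2, Y (jm.1 + i) ω|}
  have hbad (jm : ℕ × ℕ) :
      P.real (bad jm) ≤ 2 * (1 / ((jm.1 : ℝ) + 1) ^ 2 * exp (-(κ / 2)) ^ jm.2) := by
    by_cases hjm : 4 / κ * log (jm.1 + 1) ≤ jm.2
    · exact (measureReal_mono fun ω hω => hω.2).trans
        (measureReal_abs_window_sum_ge_le_of_log_le hindep hc hsub hε hκ hjm)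
    · have hempty : bad jm = ∅ := Set.eq_empty_of_forall_notMem fun ω hω => hjm hω.1
      rw [hempty, measureReal_empty]
      positivity
  have hsum : ∑' jm, P (bad jm) ≠ ⊤ := by
    have hsummable := (summable_inv_sq_mul_exp_pow (half_pos hκ0)).mul_left 2
    refine ne_top_of_le_ne_top hsummable.tsum_ofReal_ne_top (ENNReal.tsum_le_tsum fun jm => ?_)
    rw [← ofReal_measureReal]
    exact ENNReal.ofReal_le_ofReal (hbad jm)
  refine ⟨4 / κ, by positivity, ?_⟩
  filter_upwards [ae_finite_setOfPred_mem hsum] with ω hω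
  have hgood := (hω.image Prod.fst).eventually_cofinite_notMem
  rw [Nat.cofinite_eq_atTop] at hgood
  filter_upwards [hgood] with j hj m hm
  by_contra! hlt
  exact hj ⟨(j, m), ⟨hm, hlt.le⟩, rfl⟩

theorem ae_hasSmallWindowSums (hindep : iIndepFun Y P)
    (hsub : ∀ n, HasSubgaussianMGF (Y n) c P) :
    ∀ᵐ ω ∂P, HasSmallWindowSums fun n => Y n ω := by
  have hsub' (n : ℕ) : HasSubgaussianMGF (Y n) (c + 1) P :=
    ⟨(hsub n).integrable_exp_mul, fun t => ((hsub n).mgf_le t).trans <| by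
      gcongr; exact le_self_add⟩
  choose K hK0 hK using fun n : ℕ =>
    exists_ae_eventually_abs_window_sum_le hindep (by positivity) hsub'
      (Nat.one_div_pos_of_nat (α := ℝ) (n := n))
  filter_upwards [ae_all_iff.2 hK] with ω hω ε hε
  obtain ⟨n, hn⟩ := exists_nat_one_div_lt hε
  refine ⟨K n, hK0 n, ?_⟩
  filter_upwards [hω n] with j hj m hm
  exact (hj m hm).trans (by gcongr)

end WindowSums

section Geometry

variable {a b : ℝ}

theorem min_mul_moranLength_le_succ (ha : 0 < a) (hb : 0 < b) (v : ℕ → Bool) (n : ℕ) :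
    min a b * moranLength a b v n ≤ moranLength a b v (n + 1) := by
  refine mul_le_mul_of_nonneg_right ?_ (moranLength_pos ha hb v n).le
  split_ifs
  exacts [min_le_right a b, min_le_left a b]

theorem moranLength_succ_le_max_mul (ha : 0 < a) (hb : 0 < b) (v : ℕ → Bool) (n : ℕ) :
    moranLength a b v (n + 1) ≤ max a b * moranLength a b v n := by
  refine mul_le_mul_of_nonneg_right ?_ (moranLength_pos ha hb v n).le
  split_ifs
  exacts [le_max_right a b, le_max_left a b]

theorem moranLength_antitone (ha : 0 < a) (hb : 0 < b) (hab : a + b < 1) (v : ℕ → Bool) :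
    Antitone (moranLength a b v) :=
  antitone_nat_of_succ_le fun n => (moranLength_succ_le_max_mul ha hb v n).trans <|
    mul_le_of_le_one_left (moranLength_pos ha hb v n).le (max_le (by linarith) (by linarith))

theorem min_pow_le_moranLength (ha : 0 < a) (hb : 0 < b) (v : ℕ → Bool) (n : ℕ) :
    min a b ^ n ≤ moranLength a b v n := by
  induction n with
  | zero => simp [moranLength]
  | succ n ih =>
    rw [pow_succ']
    exact (mul_le_mul_of_nonneg_left ih (lt_min ha hb).le).trans
      (min_mul_moranLength_le_succ ha hb v n)

theorem moranLength_le_max_pow (ha : 0 < a) (hb : 0 < b) (v : ℕ → Bool) (n : ℕ) :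
    moranLength a b v n ≤ max a b ^ n := by
  induction n with
  | zero => simp [moranLength]
  | succ n ih =>
    rw [pow_succ']
    exact (moranLength_succ_le_max_mul ha hb v n).trans
      (mul_le_mul_of_nonneg_left ih (lt_max_of_lt_left ha).le)

theorem tendsto_moranLength (ha : 0 < a) (hb : 0 < b) (hab : a + b < 1) (v : ℕ → Bool) :
    Tendsto (moranLength a b v) atTop (𝓝 0) :=
  squeeze_zero (fun n => (moranLength_pos ha hb v n).le) (moranLength_le_max_pow ha hb v)
    (tendsto_pow_atTop_nhds_zero_of_lt_one (lt_max_of_lt_left ha).le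
      (max_lt (by linarith) (by linarith)))

theorem exists_moranLength_stopping (ha : 0 < a) (hb : 0 < b) (hab : a + b < 1) (v : ℕ → Bool)
    {s : ℝ} (hs0 : 0 < s) (hs1 : s ≤ 1) :
    ∃ n, moranLength a b v n < s ∧ min a b * s ≤ moranLength a b v n ∧
      ∀ i < n, s ≤ moranLength a b v i := by
  classical
  have hex : ∃ n, moranLength a b v n < s :=
    ((tendsto_moranLength ha hb hab v).eventually_lt_const hs0).exists
  have hbefore : ∀ i < Nat.find hex, s ≤ moranLength a b v i := fun i hi =>
    not_lt.1 (Nat.find_min hex hi)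
  refine ⟨Nat.find hex, Nat.find_spec hex, ?_, hbefore⟩
  obtain ⟨n, hn⟩ : ∃ n, Nat.find hex = n + 1 := Nat.exists_eq_succ_of_ne_zero fun h0 => by
    have := Nat.find_spec hex
    rw [h0, moranLength] at this
    exact this.not_ge hs1
  rw [hn]
  exact (mul_le_mul_of_nonneg_left (hbefore n (by lia)) (lt_min ha hb).le).trans
    (min_mul_moranLength_le_succ ha hb v n)

theorem continuous_moranLength (a b : ℝ) (n : ℕ) :
    Continuous fun v : ℕ → Bool => moranLength a b v n := by
  induction n with
  | zero => exact continuous_const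
  | succ n ih =>
    exact ((continuous_of_discreteTopology (f := fun l : Bool => if l then b else a)).comp
      (continuous_apply n)).mul ih

theorem continuous_moranLeft (a b : ℝ) (n : ℕ) :
    Continuous fun v : ℕ → Bool => moranLeft a b v n := by
  induction n with
  | zero => exact continuous_const
  | succ n ih =>
    have hstep : Continuous fun v : ℕ → Bool =>
        (if v n then (1 - b) else 0) * moranLength a b v n :=
      ((continuous_of_discreteTopology (f := fun l : Bool => if l then (1 - b) else 0)).comp
        (continuous_apply n)).mul (continuous_moranLength a b n)
    simp only [ite_mul, zero_mul] at hstep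
    exact ih.add hstep

theorem continuous_moranPoint (ha : 0 < a) (hb : 0 < b) (hab : a + b < 1) :
    Continuous (moranPoint a b) := by
  have hpow : Tendsto (fun n : ℕ => max a b ^ n) atTop (𝓝 0) :=
    tendsto_pow_atTop_nhds_zero_of_lt_one (lt_max_of_lt_left ha).le
      (max_lt (by linarith) (by linarith))
  have hunif : TendstoUniformly (fun n v => moranLeft a b v n) (moranPoint a b) atTop := by
    refine Metric.tendstoUniformly_iff.2 fun ε hε => ?_
    filter_upwards [hpow.eventually_lt_const hε] with n hn v
    have hmem := moranPoint_mem ha hb hab v n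
    rw [Real.dist_eq, abs_of_nonneg (sub_nonneg.2 hmem.1)]
    linarith [hmem.2, moranLength_le_max_pow ha hb v n]
  exact hunif.continuous (Eventually.of_forall (continuous_moranLeft a b)).frequently

theorem gap_le_abs_moranPoint_sub (ha : 0 < a) (hb : 0 < b) (hab : a + b < 1) {v w : ℕ → Bool}
    {n : ℕ} (heq : ∀ i < n, w i = v i) (hne : w n ≠ v n) :
    (1 - a - b) * moranLength a b v n ≤ |moranPoint a b w - moranPoint a b v| := by
  have hx := moranPoint_mem ha hb hab v (n + 1)
  have hy := moranPoint_mem ha hb hab w (n + 1)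
  simp only [moranInterval, moranLeft, moranLength, (moran_congr heq).1, (moran_congr heq).2,
    Set.mem_Icc] at hx hy
  cases hv : v n <;> cases hw : w n <;>
    simp only [hv, hw, ne_eq, not_true_eq_false, Bool.false_eq_true, ↓reduceIte] at hne hx hy
  · exact le_abs.2 (Or.inl (by linarith))
  · exact le_abs.2 (Or.inr (by linarith))

theorem eq_of_moranPoint_mem_ball (ha : 0 < a) (hb : 0 < b) (hab : a + b < 1)
    {v w : ℕ → Bool} {j : ℕ} {R : ℝ} (hR : ∀ i < j, R ≤ (1 - a - b) * moranLength a b v i)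
    (hw : moranPoint a b w ∈ Metric.ball (moranPoint a b v) R) : ∀ i < j, w i = v i := by
  intro i
  induction i using Nat.strong_induction_on with
  | _ i ih =>
    intro hi
    by_contra hne
    have hgap := gap_le_abs_moranPoint_sub ha hb hab (fun l hl => ih l hl (hl.trans hi)) hne
    rw [Metric.mem_ball, Real.dist_eq] at hw
    linarith [hR i hi]

/-- Mass that `moranMeasure a b q` gives to the Moran interval of step `n` along `v`; it does not
depend on the lengths `a` and `b`. -/
noncomputable def moranMass (q : ℕ → I) (v : ℕ → Bool) (n : ℕ) : ℝ :=
  ∏ i ∈ Finset.range n, (if v i then 1 - (q i : ℝ) else q i)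

theorem moranMass_pos {q : ℕ → I} (hq : ∀ i, (q i : ℝ) ∈ Set.Ioo 0 1) (v : ℕ → Bool) (n : ℕ) :
    0 < moranMass q v n := by
  refine Finset.prod_pos fun i _ => ?_
  split_ifs
  exacts [sub_pos.2 (hq i).2, (hq i).1]

theorem moranMeasure_moranInterval_eq_ofReal (ha : 0 < a) (hb : 0 < b) (hab : a + b < 1)
    (q : ℕ → I) (v : ℕ → Bool) (n : ℕ) :
    moranMeasure a b q (moranInterval a b v n) = ENNReal.ofReal (moranMass q v n) := by
  rw [moranMeasure_moranInterval ha hb hab, moranMass, ENNReal.ofReal_prod_of_nonneg]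
  intro i _
  split_ifs
  exacts [sub_nonneg.2 (q i).2.2, (q i).2.1]

theorem moranMeasure_ball_le (ha : 0 < a) (hb : 0 < b) (hab : a + b < 1) (q : ℕ → I)
    {v : ℕ → Bool} {j : ℕ} {R : ℝ} (hR : ∀ i < j, R ≤ (1 - a - b) * moranLength a b v i) :
    moranMeasure a b q (Metric.ball (moranPoint a b v) R) ≤ ENNReal.ofReal (moranMass q v j) := by
  rw [← moranMeasure_moranInterval_eq_ofReal ha hb hab, moranMeasure,
    Measure.map_apply (measurable_moranPoint a b) measurableSet_ball,
    Measure.map_apply (measurable_moranPoint a b)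
      (show MeasurableSet (moranInterval a b v j) from measurableSet_Icc)]
  exact measure_mono fun w hw =>
    (moranPoint_mem_iff ha hb hab v w j).2 (eq_of_moranPoint_mem_ball ha hb hab hR hw)

theorem ofReal_moranMass_le_moranMeasure_ball (ha : 0 < a) (hb : 0 < b) (hab : a + b < 1)
    (q : ℕ → I) {v : ℕ → Bool} {k : ℕ} {r : ℝ} (hr : moranLength a b v k < r) :
    ENNReal.ofReal (moranMass q v k) ≤ moranMeasure a b q (Metric.ball (moranPoint a b v) r) := by
  rw [← moranMeasure_moranInterval_eq_ofReal ha hb hab]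
  refine measure_mono fun y hy => ?_
  have hx := moranPoint_mem ha hb hab v k
  rw [Metric.mem_ball, Real.dist_eq, abs_lt]
  constructor <;> linarith [hx.1, hx.2, hy.1, hy.2]

theorem moranMeasure_ball_div_ball_le (ha : 0 < a) (hb : 0 < b) (hab : a + b < 1)
    {q : ℕ → I} (hq : ∀ i, (q i : ℝ) ∈ Set.Ioo 0 1) {v : ℕ → Bool} {j k : ℕ} {r R : ℝ}
    (hR : ∀ i < j, R ≤ (1 - a - b) * moranLength a b v i) (hr : moranLength a b v k < r) :
    moranMeasure a b q (Metric.ball (moranPoint a b v) R) /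
        moranMeasure a b q (Metric.ball (moranPoint a b v) r) ≤
      ENNReal.ofReal (moranMass q v j / moranMass q v k) := by
  rw [ENNReal.ofReal_div_of_pos (moranMass_pos hq v k)]
  exact ENNReal.div_le_div (moranMeasure_ball_le ha hb hab q hR)
    (ofReal_moranMass_le_moranMeasure_ball ha hb hab q hr)

theorem ofReal_moranMass_div_le (ha : 0 < a) (hb : 0 < b) (hab : a + b < 1)
    {q : ℕ → I} (hq : ∀ i, (q i : ℝ) ∈ Set.Ioo 0 1) {v : ℕ → Bool} {j k : ℕ} {r R : ℝ}
    (hR : moranLength a b v j < R) (hr : ∀ i < k, r ≤ (1 - a - b) * moranLength a b v i) :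
    ENNReal.ofReal (moranMass q v j / moranMass q v k) ≤
      moranMeasure a b q (Metric.ball (moranPoint a b v) R) /
        moranMeasure a b q (Metric.ball (moranPoint a b v) r) := by
  rw [ENNReal.ofReal_div_of_pos (moranMass_pos hq v k)]
  exact ENNReal.div_le_div (ofReal_moranMass_le_moranMeasure_ball ha hb hab q hR)
    (moranMeasure_ball_le ha hb hab q hr)

theorem support_moranMeasure_subset_range (ha : 0 < a) (hb : 0 < b) (hab : a + b < 1)
    (q : ℕ → I) : (moranMeasure a b q).support ⊆ Set.range (moranPoint a b) := by
  have hclosed : IsClosed (Set.range (moranPoint a b)) :=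
    (isCompact_range (continuous_moranPoint ha hb hab)).isClosed
  refine Measure.support_subset_of_isClosed hclosed ?_
  exact (ae_map_iff (measurable_moranPoint a b).aemeasurable hclosed.measurableSet).2
    (ae_of_all _ Set.mem_range_self)

theorem moranPoint_mem_support (ha : 0 < a) (hb : 0 < b) (hab : a + b < 1) {q : ℕ → I}
    (hq : ∀ i, (q i : ℝ) ∈ Set.Ioo 0 1) (v : ℕ → Bool) :
    moranPoint a b v ∈ (moranMeasure a b q).support := by
  refine Metric.nhds_basis_ball.mem_measureSupport.2 fun r hr => ?_
  obtain ⟨n, hn⟩ := ((tendsto_moranLength ha hb hab v).eventually_lt_const hr).exists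
  exact (ENNReal.ofReal_pos.2 (moranMass_pos hq v n)).trans_le
    (ofReal_moranMass_le_moranMeasure_ball ha hb hab q hn)

end Geometry

section LogScale

variable {a b : ℝ}

/-- For a Moran interval that gives the fraction `t` of its mass to its left child: the larger, over
the two children, of the decrease of the logarithm of the mass minus `D` times the decrease of the
logarithm of the length. -/
noncomputable def moranExcess (a b D t : ℝ) : ℝ :=
  max (D * log a - log t) (D * log b - log (1 - t))

theorem measurable_moranExcess (a b D : ℝ) : Measurable (moranExcess a b D) := by
  unfold moranExcess
  fun_prop

theorem sub_log_le_moranExcess (a b D t : ℝ) (l : Bool) :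
    D * log (if l then b else a) - log (if l then 1 - t else t) ≤ moranExcess a b D t := by
  cases l
  exacts [le_max_left _ _, le_max_right _ _]

theorem exists_sub_log_eq_moranExcess (a b D t : ℝ) :
    ∃ l : Bool, D * log (if l then b else a) - log (if l then 1 - t else t) =
      moranExcess a b D t := by
  rcases max_choice (D * log a - log t) (D * log b - log (1 - t)) with h | h
  exacts [⟨false, h.symm⟩, ⟨true, h.symm⟩]

theorem log_max_neg (ha : 0 < a) (hb : 0 < b) (hab : a + b < 1) : log (max a b) < 0 :=
  log_neg (lt_max_of_lt_left ha) (max_lt (by linarith) (by linarith))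

theorem log_moranLength_succ (ha : 0 < a) (hb : 0 < b) (v : ℕ → Bool) (n : ℕ) :
    log (moranLength a b v (n + 1)) =
      log (if v n then b else a) + log (moranLength a b v n) := by
  refine log_mul ?_ (moranLength_pos ha hb v n).ne'
  split_ifs
  exacts [hb.ne', ha.ne']

theorem log_moranMass_succ {q : ℕ → I} (hq : ∀ i, (q i : ℝ) ∈ Set.Ioo 0 1) (v : ℕ → Bool) (n : ℕ) :
    log (moranMass q v (n + 1)) =
      log (moranMass q v n) + log (if v n then 1 - (q n : ℝ) else q n) := by
  rw [moranMass, Finset.prod_range_succ, ← moranMass, log_mul (moranMass_pos hq v n).ne']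
  split_ifs
  exacts [(sub_pos.2 (hq n).2).ne', (hq n).1.ne']

theorem log_moranLength_sub_le (ha : 0 < a) (hb : 0 < b) (v : ℕ → Bool) (j m : ℕ) :
    log (moranLength a b v j) - log (moranLength a b v (j + m)) ≤ m * -log (min a b) := by
  induction m with
  | zero => simp
  | succ m ih =>
    have hL := moranLength_pos ha hb v (j + m)
    have hmin : 0 < min a b := lt_min ha hb
    have hstep := log_le_log (by positivity) (min_mul_moranLength_le_succ ha hb v (j + m))
    rw [log_mul hmin.ne' hL.ne'] at hstep
    rw [← add_assoc]
    push_cast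
    linarith

theorem le_log_moranLength_sub (ha : 0 < a) (hb : 0 < b) (v : ℕ → Bool) (j m : ℕ) :
    m * -log (max a b) ≤ log (moranLength a b v j) - log (moranLength a b v (j + m)) := by
  induction m with
  | zero => simp
  | succ m ih =>
    have hmax : 0 < max a b := lt_max_of_lt_left ha
    have hstep := log_le_log (moranLength_pos ha hb v (j + m + 1))
      (moranLength_succ_le_max_mul ha hb v (j + m))
    rw [log_mul hmax.ne' (moranLength_pos ha hb v (j + m)).ne'] at hstep
    rw [← add_assoc]
    push_cast
    linarith

theorem le_neg_log_moranLength (ha : 0 < a) (hb : 0 < b) (v : ℕ → Bool) (n : ℕ) :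
    n * -log (max a b) ≤ -log (moranLength a b v n) := by
  simpa [moranLength] using le_log_moranLength_sub ha hb v 0 n

theorem log_moranMass_sub_le (ha : 0 < a) (hb : 0 < b) {q : ℕ → I}
    (hq : ∀ i, (q i : ℝ) ∈ Set.Ioo 0 1) (D : ℝ) (v : ℕ → Bool) (j m : ℕ) :
    log (moranMass q v j) - log (moranMass q v (j + m)) ≤
      D * (log (moranLength a b v j) - log (moranLength a b v (j + m))) +
        ∑ i ∈ Finset.range m, moranExcess a b D (q (j + i)) := by
  induction m with
  | zero => simp
  | succ m ih =>
    rw [← add_assoc, log_moranLength_succ ha hb, log_moranMass_succ hq, Finset.sum_range_succ]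
    linarith [sub_log_le_moranExcess a b D (q (j + m)) (v (j + m))]

theorem exists_neg_log_moranMass_eq (ha : 0 < a) (hb : 0 < b) {q : ℕ → I}
    (hq : ∀ i, (q i : ℝ) ∈ Set.Ioo 0 1) (D : ℝ) :
    ∃ v, ∀ n, -log (moranMass q v n) =
      D * -log (moranLength a b v n) + ∑ i ∈ Finset.range n, moranExcess a b D (q i) := by
  choose v hv using fun i => exists_sub_log_eq_moranExcess a b D (q i)
  refine ⟨v, fun n => ?_⟩
  induction n with
  | zero => simp [moranMass, moranLength]
  | succ n ih =>
    rw [log_moranLength_succ ha hb, log_moranMass_succ hq, Finset.sum_range_succ]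
    linarith [hv n]

end LogScale

section Dimension

theorem tendsto_abs_log_nhdsGT_zero : Tendsto (fun t => |log t|) (𝓝[>] 0) atTop :=
  tendsto_abs_atBot_atTop.comp tendsto_log_nhdsGT_zero

theorem IsLargeDimensionFunction.eventually_mul_log_abs_log_le {Φ : ℝ → ℝ}
    (hΦ : IsLargeDimensionFunction Φ) (h : ℝ) :
    ∀ᶠ t in 𝓝[>] (0 : ℝ), h * log |log t| ≤ Φ t * |log t| := by
  obtain ⟨H, hH, heq⟩ := hΦ
  filter_upwards [heq, hH.eventually_ge_atTop h, tendsto_abs_log_nhdsGT_zero.eventually_ge_atTop 1]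
    with t ht hHt hlog
  rw [ht, mul_assoc, div_mul_cancel₀ _ (by positivity)]
  exact mul_le_mul_of_nonneg_right hHt (log_nonneg hlog)

theorem IsLargeDimensionFunction.eventually_nonneg {Φ : ℝ → ℝ}
    (hΦ : IsLargeDimensionFunction Φ) : ∀ᶠ t in 𝓝[>] (0 : ℝ), 0 ≤ Φ t := by
  filter_upwards [hΦ.eventually_mul_log_abs_log_le 0,
    tendsto_abs_log_nhdsGT_zero.eventually_gt_atTop 0] with t ht hlog
  rw [zero_mul] at ht
  exact nonneg_of_mul_nonneg_left ht hlog

variable {a b D d : ℝ} {q : ℕ → I} {Φ : ℝ → ℝ}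

theorem eventually_log_succ_le_two_mul_log_abs_log (ha : 0 < a) (hb : 0 < b) (hab : a + b < 1) :
    ∀ᶠ R in 𝓝[>] (0 : ℝ), ∀ (v : ℕ → Bool) (j : ℕ), min a b * R ≤ moranLength a b v j →
      log (j + 1) ≤ 2 * log |log R| := by
  have hmin : 0 < min a b := lt_min ha hb
  set lam := -log (max a b)
  have hlam : 0 < lam := neg_pos.2 (log_max_neg ha hb hab)
  filter_upwards [Ioo_mem_nhdsGT one_pos, tendsto_abs_log_nhdsGT_zero.eventually_ge_atTop 1,
    tendsto_abs_log_nhdsGT_zero.eventually_ge_atTop (2 / lam),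
    tendsto_abs_log_nhdsGT_zero.eventually_ge_atTop (2 * (-log (min a b) / lam + 1))]
    with R ⟨hR0, hR1⟩ hone hquad hconst v j hj
  have hlevel : j * lam ≤ -log (min a b) + |log R| := by
    rw [abs_of_neg (log_neg hR0 hR1)]
    have hlog := log_le_log (by positivity) hj
    rw [log_mul hmin.ne' hR0.ne'] at hlog
    linarith [le_neg_log_moranLength ha hb v j]
  have hsq : (j : ℝ) + 1 ≤ |log R| ^ 2 := by
    have hj' : (j : ℝ) ≤ -log (min a b) / lam + |log R| / lam := by
      rwa [← add_div, le_div_iff₀ hlam]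
    have hlin : |log R| / lam ≤ |log R| ^ 2 / 2 := by
      calc |log R| / lam = |log R| * (2 / lam) / 2 := by ring
        _ ≤ |log R| ^ 2 / 2 := by rw [sq]; gcongr
    nlinarith
  calc log (j + 1) ≤ log (|log R| ^ 2) := log_le_log (by positivity) hsq
    _ = 2 * log |log R| := by rw [log_pow]; norm_num

theorem eventually_mul_log_succ_le (ha : 0 < a) (hb : 0 < b) (hab : a + b < 1)
    (hΦ : IsLargeDimensionFunction Φ) {K : ℝ} (hK : 0 ≤ K) :
    ∀ᶠ R in 𝓝[>] (0 : ℝ), ∀ (v : ℕ → Bool) (j m : ℕ), min a b * R ≤ moranLength a b v j →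
      moranLength a b v (j + m) ≤ R ^ (1 + Φ R) → K * log (j + 1) ≤ m := by
  have hmin : 0 < min a b := lt_min ha hb
  set α := -log (min a b)
  have hα : 0 < α := neg_pos.2 <| log_neg hmin (min_lt_of_left_lt (by linarith))
  filter_upwards [Ioo_mem_nhdsGT one_pos,
    eventually_log_succ_le_two_mul_log_abs_log ha hb hab,
    hΦ.eventually_mul_log_abs_log_le (2 * α * K + 1),
    (tendsto_log_atTop.comp tendsto_abs_log_nhdsGT_zero).eventually_ge_atTop α]
    with R ⟨hR0, hR1⟩ hlevel hlarge hloglog v j m hj hjm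
  have hlogj := log_le_log (by positivity) hj
  have hlogjm := log_le_log (moranLength_pos ha hb v (j + m)) hjm
  rw [log_mul hmin.ne' hR0.ne'] at hlogj
  rw [log_rpow hR0] at hlogjm
  have hdrop := log_moranLength_sub_le ha hb v j m
  have hlogR : |log R| = -log R := abs_of_neg (log_neg hR0 hR1)
  have hgain : 2 * α * K * log |log R| ≤ m * α := by
    simp only [Function.comp_apply] at hloglog
    have : Φ R * |log R| = -(Φ R * log R) := by rw [hlogR]; ring
    linarith
  have hstart : K * α * log (j + 1) ≤ K * α * (2 * log |log R|) := by
    gcongr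
    exact hlevel v j hj
  refine le_of_mul_le_mul_right ?_ hα
  linarith

theorem HasSmallWindowSums.exists_eventually_log_moranMass_sub_le (ha : 0 < a) (hb : 0 < b)
    (hab : a + b < 1) (hq : ∀ i, (q i : ℝ) ∈ Set.Ioo 0 1)
    (hsmall : HasSmallWindowSums fun i => moranExcess a b D (q i)) (hd : D < d) :
    ∃ K ≥ 0, ∀ᶠ j : ℕ in atTop, ∀ m : ℕ, K * log (j + 1) ≤ m → ∀ v : ℕ → Bool,
      log (moranMass q v j) - log (moranMass q v (j + m)) ≤
        d * (log (moranLength a b v j) - log (moranLength a b v (j + m))) := by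
  have hmax : 0 < -log (max a b) := neg_pos.2 (log_max_neg ha hb hab)
  obtain ⟨K, hK0, hK⟩ := hsmall ((d - D) * -log (max a b)) (mul_pos (sub_pos.2 hd) hmax)
  refine ⟨K, hK0, ?_⟩
  filter_upwards [hK] with j hj m hm v
  have hexcess := (le_abs_self _).trans (hj m hm)
  have hlength := mul_le_mul_of_nonneg_left (le_log_moranLength_sub ha hb v j m) (sub_pos.2 hd).le
  linarith [log_moranMass_sub_le ha hb hq D v j m]

theorem exists_levels_moranMeasure_ball_div_ball_le (ha : 0 < a) (hb : 0 < b) (hab : a + b < 1)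
    (hq : ∀ i, (q i : ℝ) ∈ Set.Ioo 0 1) (v : ℕ → Bool) {r R : ℝ} (hr0 : 0 < r) (hrR : r ≤ R)
    (hR : R ≤ 1 - a - b) :
    ∃ j m : ℕ, moranLength a b v j ∈ Set.Ico (min a b * (R / (1 - a - b))) (R / (1 - a - b)) ∧
      moranLength a b v (j + m) ∈ Set.Ico (min a b * r) r ∧
      moranMeasure a b q (Metric.ball (moranPoint a b v) R) /
          moranMeasure a b q (Metric.ball (moranPoint a b v) r) ≤
        ENNReal.ofReal (moranMass q v j / moranMass q v (j + m)) := by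
  have hgap : 0 < 1 - a - b := by linarith
  obtain ⟨j, hj, hj', hbefore⟩ := exists_moranLength_stopping ha hb hab v
    (div_pos (hr0.trans_le hrR) hgap) ((div_le_one hgap).2 hR)
  obtain ⟨k, hk, hk', -⟩ := exists_moranLength_stopping ha hb hab v hr0 (by linarith)
  have hjk : j ≤ k := by
    by_contra! hkj
    have hRk := (div_le_iff₀ hgap).1 (hbefore k hkj)
    nlinarith [moranLength_pos ha hb v k]
  obtain ⟨m, rfl⟩ := Nat.exists_eq_add_of_le hjk
  refine ⟨j, m, ⟨hj', hj⟩, ⟨hk', hk⟩, moranMeasure_ball_div_ball_le ha hb hab hq ?_ hk⟩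
  intro i hi
  rw [← div_le_iff₀' hgap]
  exact hbefore i hi

theorem mul_log_sub_log_le {c g x y r R : ℝ} (hc : 0 < c) (hg0 : 0 < g) (hg1 : g ≤ 1)
    (hr : 0 < r) (hR : 0 < R) (hx : x ∈ Set.Ico (c * (R / g)) (R / g))
    (hy : y ∈ Set.Ico (c * r) r) (d : ℝ) :
    d * (log x - log y) ≤ |d| * (-log c - log g) + d * log (R / r) := by
  have hx0 : 0 < x := lt_of_lt_of_le (by positivity) hx.1
  have hy0 : 0 < y := lt_of_lt_of_le (by positivity) hy.1
  have hx1 := log_le_log (by positivity) hx.1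
  have hx2 := log_le_log hx0 hx.2.le
  have hy1 := log_le_log (by positivity) hy.1
  have hy2 := log_le_log hy0 hy.2.le
  rw [log_mul hc.ne' (by positivity)] at hx1
  rw [log_div hR.ne' hg0.ne'] at hx1 hx2
  rw [log_mul hc.ne' hr.ne'] at hy1
  have hclose : |log x - log y - log (R / r)| ≤ -log c - log g := by
    rw [log_div hR.ne' hr.ne', abs_le]
    constructor <;> linarith [log_nonpos hg0.le hg1]
  have hscaled := mul_le_mul_of_nonneg_left hclose (abs_nonneg d)
  rw [← abs_mul] at hscaled
  linarith [le_abs_self (d * (log x - log y - log (R / r)))]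

theorem isUpperPhiExponent_moranMeasure (ha : 0 < a) (hb : 0 < b) (hab : a + b < 1)
    (hq : ∀ i, (q i : ℝ) ∈ Set.Ioo 0 1)
    (hsmall : HasSmallWindowSums fun i => moranExcess a b D (q i))
    (hΦ : IsLargeDimensionFunction Φ) (hd : D < d) :
    IsUpperPhiExponent Φ (moranMeasure a b q) d := by
  have hmin0 : 0 < min a b := lt_min ha hb
  have hmin1 : min a b < 1 := min_lt_of_left_lt (by linarith)
  have hgap : 0 < 1 - a - b := by linarith
  obtain ⟨K, hK0, hK⟩ := hsmall.exists_eventually_log_moranMass_sub_le ha hb hab hq hd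
  obtain ⟨N, hN⟩ := eventually_atTop.1 hK
  obtain ⟨C₁, hC₁, hscale⟩ := mem_nhdsGT_iff_exists_Ioc_subset.1 <|
    (eventually_mul_log_succ_le ha hb hab hΦ hK0).and
      (Ioc_mem_nhdsGT (mul_pos hgap (pow_pos hmin0 N)))
  refine ⟨C₁, hC₁, exp (|d| * (-log (min a b) - log (1 - a - b))), exp_pos _, ?_⟩
  rintro r R ⟨hR0, -⟩ hr0 hrR hRR hRC₁ x hx
  obtain ⟨v, rfl⟩ := support_moranMeasure_subset_range ha hb hab q hx
  obtain ⟨hlong, -, hRN⟩ := hscale ⟨hR0, hRC₁⟩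
  obtain ⟨j, m, hj, hjm, hratio⟩ := exists_levels_moranMeasure_ball_div_ball_le ha hb hab hq v hr0
    (hrR.le.trans hRR) (hRN.trans (mul_le_of_le_one_right hgap.le (pow_le_one₀ hmin0.le hmin1.le)))
  have hpow : min a b ^ j < min a b ^ N :=
    ((min_pow_le_moranLength ha hb v j).trans_lt hj.2).trans_le ((div_le_iff₀' hgap).2 hRN)
  have hNj : N ≤ j := ((pow_lt_pow_iff_right_of_lt_one₀ hmin0 hmin1).1 hpow).le
  have hwindow : K * log (j + 1) ≤ m :=
    hlong v j m ((mul_le_mul_of_nonneg_left (le_div_self hR0.le hgap (by linarith))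
      hmin0.le).trans hj.1) (hjm.2.le.trans hrR.le)
  refine hratio.trans (ENNReal.ofReal_le_ofReal ?_)
  have hMj := moranMass_pos hq v j
  have hMjm := moranMass_pos hq v (j + m)
  rw [rpow_def_of_pos (div_pos hR0 hr0), ← exp_add, ← log_le_iff_le_exp (div_pos hMj hMjm),
    log_div hMj.ne' hMjm.ne', mul_comm (log (R / r))]
  exact (hN j hNj m hwindow v).trans
    (mul_log_sub_log_le hmin0 hgap (by linarith) hr0 hR0 hj hjm d)

theorem IsUpperPhiExponent.exists_eventually_neg_log_moranMass_le (ha : 0 < a) (hb : 0 < b)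
    (hab : a + b < 1) (hq : ∀ i, (q i : ℝ) ∈ Set.Ioo 0 1)
    (hd : IsUpperPhiExponent Φ (moranMeasure a b q) d)
    (hΦ : ∀ᶠ t in 𝓝[>] (0 : ℝ), 0 ≤ Φ t) (v : ℕ → Bool) :
    ∃ C, ∀ᶠ n in atTop, -log (moranMass q v n) ≤ C + d * -log (moranLength a b v n) := by
  have hgap : 0 < 1 - a - b := by linarith
  have hlength := tendsto_moranLength ha hb hab v
  obtain ⟨C₁, hC₁, C₂, hC₂, hbound⟩ := hd
  obtain ⟨R, hΦR, hR01, -, hRC₁⟩ :=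
    (hΦ.and (inter_mem (Ioo_mem_nhdsGT one_pos) (Ioc_mem_nhdsGT hC₁))).exists
  have hR0 : 0 < R := hR01.1
  obtain ⟨k, hk⟩ := (hlength.eventually_lt_const hR0).exists
  refine ⟨log C₂ + d * (log R - log (1 - a - b)) - log (moranMass q v k), ?_⟩
  have hsmall : Tendsto (fun n => (1 - a - b) * moranLength a b v n) atTop (𝓝 0) := by
    simpa using hlength.const_mul (1 - a - b)
  filter_upwards [hsmall.eventually_lt_const (rpow_pos_of_pos hR0 (1 + Φ R))] with n hn
  have hL := moranLength_pos ha hb v n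
  have hMk := moranMass_pos hq v k
  have hMn := moranMass_pos hq v n
  have hratio : moranMass q v k / moranMass q v n ≤
      C₂ * (R / ((1 - a - b) * moranLength a b v n)) ^ d := by
    rw [← ENNReal.ofReal_le_ofReal_iff (by positivity)]
    refine (ofReal_moranMass_div_le ha hb hab hq hk fun i hi => ?_).trans
      (hbound _ R hR01 (by positivity) hn ?_ hRC₁ _ (moranPoint_mem_support ha hb hab hq v))
    · gcongr
      exact moranLength_antitone ha hb hab v hi.le
    · exact rpow_le_self_of_le_one hR0.le hR01.2.le (by linarith)
  have hlog := log_le_log (by positivity) hratio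
  rw [log_div hMk.ne' hMn.ne', log_mul hC₂.ne' (by positivity), log_rpow (by positivity),
    log_div hR0.ne' (by positivity), log_mul hgap.ne' hL.ne'] at hlog
  linarith

theorem le_of_isUpperPhiExponent_moranMeasure (ha : 0 < a) (hb : 0 < b) (hab : a + b < 1)
    (hq : ∀ i, (q i : ℝ) ∈ Set.Ioo 0 1)
    (hmean : (fun n => ∑ i ∈ Finset.range n, moranExcess a b D (q i)) =o[atTop]
      fun n : ℕ => (n : ℝ))
    (hΦ : ∀ᶠ t in 𝓝[>] (0 : ℝ), 0 ≤ Φ t) (hd : IsUpperPhiExponent Φ (moranMeasure a b q) d) :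
    D ≤ d := by
  by_contra! hdD
  have hmax : 0 < -log (max a b) := neg_pos.2 (log_max_neg ha hb hab)
  obtain ⟨v, hv⟩ := exists_neg_log_moranMass_eq ha hb hq D
  obtain ⟨C, hC⟩ := hd.exists_eventually_neg_log_moranMass_le ha hb hab hq hΦ v
  have hrate : 0 < (D - d) / 2 * -log (max a b) := mul_pos (half_pos (sub_pos.2 hdD)) hmax
  have hgrowth : Tendsto (fun n : ℕ => (D - d) / 2 * -log (max a b) * n) atTop atTop :=
    tendsto_natCast_atTop_atTop.const_mul_atTop hrate
  obtain ⟨n, hn, hexcess, hlarge⟩ :=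
    (hC.and ((Asymptotics.isLittleO_iff.1 hmean hrate).and (hgrowth.eventually_gt_atTop C))).exists
  rw [norm_eq_abs, norm_natCast] at hexcess
  have hlength := mul_le_mul_of_nonneg_left (le_neg_log_moranLength ha hb v n) (sub_pos.2 hdD).le
  rw [hv n] at hn
  linarith [neg_le_of_abs_le hexcess]

theorem upperPhiDim_moranMeasure (ha : 0 < a) (hb : 0 < b) (hab : a + b < 1)
    (hq : ∀ i, (q i : ℝ) ∈ Set.Ioo 0 1)
    (hsmall : HasSmallWindowSums fun i => moranExcess a b D (q i))
    (hΦ : IsLargeDimensionFunction Φ) : upperPhiDim Φ (moranMeasure a b q) = D := by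
  apply le_antisymm
  · refine EReal.le_of_forall_lt_iff_le.1 fun d hd => sInf_le ⟨d, ?_, rfl⟩
    exact isUpperPhiExponent_moranMeasure ha hb hab hq hsmall hΦ (EReal.coe_lt_coe_iff.1 hd)
  · refine le_sInf ?_
    rintro _ ⟨d, hd, rfl⟩
    exact EReal.coe_le_coe_iff.2 <| le_of_isUpperPhiExponent_moranMeasure ha hb hab hq
      hsmall.sum_range_isLittleO hΦ.eventually_nonneg hd

end Dimension

section RandomWeights

variable {a b : ℝ} {Ω : Type*} [MeasurableSpace Ω] {P : Measure Ω}

theorem ae_upperPhiDim_moranMeasure {D : ℝ} {X : ℕ → Ω → I} {c : NNReal} (ha : 0 < a) (hb : 0 < b)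
    (hab : a + b < 1) (hindep : iIndepFun X P) (hX : ∀ n, ∀ᵐ ω ∂P, (X n ω : ℝ) ∈ Set.Ioo 0 1)
    (hsub : ∀ n, HasSubgaussianMGF (fun ω => moranExcess a b D (X n ω)) c P) :
    ∀ᵐ ω ∂P, ∀ Φ : ℝ → ℝ, IsLargeDimensionFunction Φ →
      upperPhiDim Φ (moranMeasure a b fun n => X n ω) = D := by
  have hexcess : iIndepFun (fun n ω => moranExcess a b D (X n ω)) P :=
    hindep.comp (fun _ t => moranExcess a b D t) fun _ =>
      (measurable_moranExcess a b D).comp measurable_subtype_coe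
  filter_upwards [ae_hasSmallWindowSums hexcess hsub, ae_all_iff.2 hX] with ω hsmall hω Φ hΦ
  exact upperPhiDim_moranMeasure ha hb hab hω hsmall hΦ

theorem integral_uniformOn_finset {α E : Type*} [MeasurableSpace α] [MeasurableSingletonClass α]
    [NormedAddCommGroup E] [NormedSpace ℝ E] [CompleteSpace E] (s : Finset α) (f : α → E) :
    ∫ z, f z ∂(uniformOn (s : Set α)) = (s.card : ℝ)⁻¹ • ∑ z ∈ s, f z := by
  have hint : IntegrableOn f s Measure.count := by
    rw [← Set.biUnion_of_singleton (s : Set α)]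
    exact integrableOn_finset_iUnion.2 fun _ _ => integrableOn_singleton (hx := by simp)
  rw [uniformOn, ProbabilityTheory.cond, integral_smul_measure, setIntegral_finset s hint,
    Measure.count_apply_finset]
  simp

variable {α : Type*} [MeasurableSpace α] [MeasurableSingletonClass α] {X : Ω → α}

theorem ae_mem_of_map_eq_uniformOn {s : Set α} (hs : s.Finite) (hs' : s.Nonempty)
    (hX : P.map X = uniformOn s) : ∀ᵐ ω ∂P, X ω ∈ s := by
  have := isProbabilityMeasure_uniformOn hs hs'
  have hXm : AEMeasurable X P := aemeasurable_of_map_neZero (by rw [hX]; infer_instance)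
  exact ae_of_ae_map hXm (hX ▸ ae_cond_mem hs.measurableSet)

theorem hasSubgaussianMGF_of_map_eq_uniformOn_pair {x y : α} (hX : P.map X = uniformOn {x, y})
    {f : α → ℝ} (hf : Measurable f) (hxy : f x + f y = 0) :
    HasSubgaussianMGF (fun ω => f (X ω)) (‖f x‖₊ ^ 2) P := by
  classical
  have hpair : ({x, y} : Set α).Finite := Set.toFinite _
  have := isProbabilityMeasure_uniformOn hpair (Set.insert_nonempty _ _)
  have hXm : AEMeasurable X P := aemeasurable_of_map_neZero (by rw [hX]; infer_instance)
  have : IsProbabilityMeasure (P.map X) := by rw [hX]; infer_instance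
  have := P.isProbabilityMeasure_of_map X
  have hmean : P[fun ω => f (X ω)] = 0 := by
    have hsum : ∑ z ∈ ({x, y} : Finset α), f z = 0 := by
      rcases eq_or_ne x y with rfl | hne
      · simpa using hxy
      · rwa [Finset.sum_pair hne]
    rw [← integral_map hXm hf.aestronglyMeasurable, hX, ← Finset.coe_pair,
      integral_uniformOn_finset, hsum, smul_zero]
  have hmem : ∀ᵐ ω ∂P, f (X ω) ∈ Set.Icc (-|f x|) |f x| := by
    filter_upwards [ae_mem_of_map_eq_uniformOn hpair (Set.insert_nonempty _ _) hX] with ω hω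
    rw [Set.mem_Icc, ← abs_le]
    rcases hω with h | h
    · rw [h]
    · rw [h, eq_neg_of_add_eq_zero_right hxy, abs_neg]
  have hradius : (‖|f x| - -|f x|‖₊ / 2) ^ 2 = ‖f x‖₊ ^ 2 := by
    rw [← NNReal.coe_inj]
    simp [← two_mul]
  exact hradius ▸
    hasSubgaussianMGF_of_mem_Icc_of_integral_eq_zero (hf.comp_aemeasurable hXm) hmem hmean

theorem max_div_mul_sub_eq_zero {x y s t : ℝ} (hx : x < 0) (hy : y < 0) :
    max (max (s / x) (t / y) * x - s) (max (s / x) (t / y) * y - t) = 0 := by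
  apply le_antisymm
  · refine max_le (sub_nonpos.2 ?_) (sub_nonpos.2 ?_)
    exacts [(div_le_iff_of_neg hx).1 (le_max_left _ _), (div_le_iff_of_neg hy).1 (le_max_right _ _)]
  · rcases max_choice (s / x) (t / y) with h | h <;> rw [h]
    exacts [le_max_of_le_left (by rw [div_mul_cancel₀ _ hx.ne, sub_self]),
      le_max_of_le_right (by rw [div_mul_cancel₀ _ hy.ne, sub_self])]

theorem moranExcess_add_moranExcess_one_sub_eq_zero {D p : ℝ} (ha : 0 < a) (hab : a ≤ b)
    (hb : b < 1) (hp0 : 0 < p) (hp : p ≤ 1 / 2)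
    (hD : D = max (log p / ((1 / 2) * (log a + log b))) ((log p + log (1 - p)) / (2 * log b))) :
    moranExcess a b D p + moranExcess a b D (1 - p) = 0 := by
  have hlogb : log b < 0 := log_neg (ha.trans_le hab) hb
  have hloga : log a ≤ log b := log_le_log ha hab
  have hlogp : log p ≤ log (1 - p) := log_le_log hp0 (by linarith)
  have hlogq : log (1 - p) < 0 := log_neg (by linarith) (by linarith)
  have hD0 : 0 ≤ D := hD ▸ le_max_of_le_right
    (div_nonneg_of_nonpos (by linarith) (by linarith))
  have hheavy : moranExcess a b D (1 - p) = D * log b - log p := by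
    rw [moranExcess, sub_sub_cancel]
    exact max_eq_right (sub_le_sub (mul_le_mul_of_nonneg_left hloga hD0) hlogp)
  -- The sum of the two excesses is the maximum of `D * (log a + log b) - 2 * log p` and
  -- `D * (2 * log b) - (log p + log (1 - p))`, and `D` is the larger of their two zeros.
  have hbalance := max_div_mul_sub_eq_zero (s := 2 * log p) (t := log p + log (1 - p))
    (x := log a + log b) (y := 2 * log b) (by linarith) (by linarith)
  have hD₂ : 2 * log p / (log a + log b) = log p / ((1 / 2) * (log a + log b)) := by
    field_simp
  rw [hD₂, ← hD] at hbalance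
  rw [hheavy, moranExcess, max_add, ← hbalance]
  congr 1 <;> ring

theorem log_div_le_log_div_iff {p β η : ℝ} (ha0 : 0 < a) (ha1 : a < 1) (hb : b < 1) (hp0 : 0 < p)
    (hp1 : p < 1) (hβ : a ^ β = b) (hη : (1 - p) ^ η = p) :
    log p / ((1 / 2) * (log a + log b)) ≤ (log p + log (1 - p)) / (2 * log b) ↔
      0 ≤ η + 1 + β - 3 * η * β := by
  have hloga : log a < 0 := log_neg ha0 ha1
  have hlogb : log b < 0 := log_neg (hβ ▸ rpow_pos_of_pos ha0 β) hb
  have hlogq : log (1 - p) < 0 := log_neg (by linarith) (by linarith)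
  have hlogβ : log b = β * log a := by rw [← hβ, log_rpow ha0]
  have hlogη : log p = η * log (1 - p) := by
    conv_lhs => rw [← hη, log_rpow (by linarith)]
  have hfactor : 0 < log (1 - p) * log a / (2 * log b * (log a + log b)) :=
    div_pos (mul_pos_of_neg_of_neg hlogq hloga)
      (mul_pos_of_neg_of_neg (by linarith) (by linarith))
  have hdiff : (log p + log (1 - p)) / (2 * log b) - log p / ((1 / 2) * (log a + log b)) =
      log (1 - p) * log a / (2 * log b * (log a + log b)) * (η + 1 + β - 3 * η * β) := by
    have hlogb' : log b ≠ 0 := hlogb.ne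
    have hsum : log a + log b ≠ 0 := by linarith
    field_simp
    rw [hlogη, hlogβ]
    ring
  rw [← sub_nonneg, hdiff, mul_nonneg_iff_of_pos_left hfactor]

end RandomWeights

theorem mainTheorem11_general {Ω : Type*} [MeasurableSpace Ω] (P : Measure Ω)
    (a b : ℝ) (ha : 0 < a) (hab : a ≤ b) (hsum : a + b < 1)
    (p : unitInterval) (hp_pos : 0 < (p : ℝ)) (hp_le : (p : ℝ) ≤ 1 / 2)
    (X : ℕ → Ω → unitInterval) (hX_indep : iIndepFun X P)
    (hX_law : ∀ n, P.map (X n) = uniformOn {p, unitInterval.symm p})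
    (β η : ℝ) (hβ : a ^ β = b) (hη : (1 - (p : ℝ)) ^ η = p) :
    ∀ᵐ ω ∂P, ∀ Φ : ℝ → ℝ, IsLargeDimensionFunction Φ →
      upperPhiDim Φ (moranMeasure a b fun n => X n ω) =
        ((if 0 ≤ η + 1 + β - 3 * η * β then
            (Real.log p + Real.log (1 - p)) / (2 * Real.log b)
          else
            Real.log p / ((1 / 2) * (Real.log a + Real.log b)) : ℝ) : EReal) := by
  have hsign := log_div_le_log_div_iff ha (by linarith) (by linarith) hp_pos (by linarith) hβ hη
  simp only [← hsign, ← max_def]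
  have hbalance := moranExcess_add_moranExcess_one_sub_eq_zero ha hab (by linarith) hp_pos hp_le rfl
  refine ae_upperPhiDim_moranMeasure ha (by linarith) hsum hX_indep (fun n => ?_) fun n =>
    hasSubgaussianMGF_of_map_eq_uniformOn_pair (hX_law n)
      ((measurable_moranExcess a b _).comp measurable_subtype_coe) hbalance
  filter_upwards [ae_mem_of_map_eq_uniformOn (Set.toFinite _) (Set.insert_nonempty _ _) (hX_law n)]
    with ω hω
  rcases hω with h | h
  · rw [h]
    constructor <;> linarith
  · rw [h, unitInterval.coe_symm_eq]
    constructor <;> linarith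

theorem mainTheorem11 {Ω : Type*} [MeasurableSpace Ω] (P : Measure Ω) [IsProbabilityMeasure P]
    (a b : ℝ) (ha : 0 < a) (hab : a < b) (hsum : a + b < 1)
    (p : unitInterval) (hp_pos : 0 < (p : ℝ)) (hp_lt : (p : ℝ) < 1 / 2)
    (X : ℕ → Ω → unitInterval) (hX_meas : ∀ n, Measurable (X n))
    (hX_indep : iIndepFun X P)
    (hX_law : ∀ n, P.map (X n) = uniformOn {p, unitInterval.symm p})
    (β η : ℝ) (hβ : a ^ β = b) (hη : (1 - (p : ℝ)) ^ η = p) :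
    ∀ᵐ ω ∂P, ∀ Φ : ℝ → ℝ, IsDimensionFunction Φ → IsLargeDimensionFunction Φ →
      upperPhiDim Φ (moranMeasure a b fun n => X n ω) =
        ((if 0 ≤ η + 1 + β - 3 * η * β then
            (Real.log p + Real.log (1 - p)) / (2 * Real.log b)
          else
            Real.log p / ((1 / 2) * (Real.log a + Real.log b)) : ℝ) : EReal) := by
  filter_upwards [mainTheorem11_general P a b ha hab.le hsum p hp_pos hp_lt.le X hX_indep hX_law
    β η hβ hη] with ω hω Φ _ hlarge using hω Φ hlarge
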